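/- Let $M$ be a smooth manifold of odd dimension $n$, let $F\in\Omega^2(M)$ and $H\in\Omega^3(M)$ satisfy $dF=0$ and $dH=-F\wedge F$, and let $E=TM\oplus T^*M\oplus\mathbb{R}$ be the Courant algebroid of type $B_n$ twisted by $(H,F)$: its anchor $\pi:E\to TM$ is the projection, its scalar product is $\langle X+\xi+\lambda,Y+\eta+\mu\rangle=\frac12(\eta(X)+\xi(Y))+\lambda\mu$, and its Dorfman bracket is $$[X+\xi+\lambda,Y+\eta+\mu]=\mathcal L_XY+\mathcal L_X\eta-i_Yd\xi+2\mu\,d\lambda+i_Xi_YH-2(\mu\, i_XF-\lambda\, i_YF)+X(\mu)-Y(\lambda)+F(X,Y).$$ A (admissible) generalized metric $\mathcal G$ is a subbundle $E_-\subset E$ on which $\langle\cdot,\cdot\rangle$ is non-degenerate and which $\pi$ maps isomorphically onto $TM$. Put $E_+=E_-^\perp$, $\mathcal G^{\mathrm{end}}|_{E_\pm}=\pm\mathrm{Id}$, $s=(\pi|_{E_-})^{-1}$, and let $g(X,Y)=-\langle s(X),s(Y)\rangle$ be the induced pseudo-Riemannian metric. A $B_n$-generalized almost complex structure is an isotropic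 complex subbundle $L\subset E_{\mathbb C}$ of rank $n$ with $L\cap\bar L=0$, or equivalently the endomorphism $\mathcal F$ of $E$ equal to $i$ on $L$, to $-i$ on $\bar L$ and to $0$ on $(L\oplus\bar L)^\perp$; it is integrable if the sections of $L$ are closed under the (complexified) Dorfman bracket. The pair $(\mathcal G,\mathcal F)$ is a $B_n$-generalized pseudo-Kähler structure if $\mathcal G^{\mathrm{end}}\mathcal F=\mathcal F\mathcal G^{\mathrm{end}}$ and both $\mathcal F$ and $\mathcal G^{\mathrm{end}}\mathcal F$ are integrable $B_n$-generalized almost complex structures. Let $(\mathcal G,\mathcal F)$ be such a structure, and let $(g,J_+,J_-,X_+,X_-)$ be its components, defined as follows. Let $u_-$ be a section of $\mathrm{Ker}\,\mathcal F$ with $\langle u_-,u_-\rangle=(-1)^n=-1$ (it is unique up to sign). Then $X_-=\pi(u_-)$ and $J_-=\pi\circ\mathcal F\circ s$. Identify $TM\oplus\mathbb R$ with $E_+$ by $Y+a\mapsto s_+(Y)+a\,e$, where $s_+(Y)=s(Y)+2\,i_Yg$ and $e=1-2A$, with $A(Y)$ the $\mathbb R$-component of $s(Y)$; then $J_+Y=\pi(\mathcal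 F s_+(Y))$ and $X_+=\pi(\mathcal F e)$. (If $E_-=\{X-i_Xg\}$ is in the standard form, then $s(X)=X-i_Xg$, $s_+(X)=X+i_Xg$ and $e=1$.) Then $X_-$ is a Killing vector field of $g$, it commutes with $X_+$, that is $[X_-,X_+]=0$, and it preserves $J_+$ and $J_-$, that is $\mathcal L_{X_-}J_+=0$ and $\mathcal L_{X_-}J_-=0$. -/

import Mathlib

open Bundle Manifold VectorField
open scoped Manifold ContDiff TensorProduct

noncomputable section

namespace BnGeom

section Calculus

variable {n : ℕ} {M : Type*} [TopologicalSpace M] [ChartedSpace (EuclideanSpace ℝ (Fin n)) M]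

/-- The tangent space `T_pM` of an `n`-dimensional manifold. -/
abbrev Tan (n : ℕ) {M : Type*} [TopologicalSpace M] [ChartedSpace (EuclideanSpace ℝ (Fin n)) M]
    (p : M) : Type :=
  TangentSpace (𝓡 n) p

/-- The cotangent space `T_p^*M`. -/
abbrev Cotan (n : ℕ) {M : Type*} [TopologicalSpace M] [ChartedSpace (EuclideanSpace ℝ (Fin n)) M]
    (p : M) : Type :=
  TangentSpace (𝓡 n) p →L[ℝ] ℝ

/-- `X(f)`: the derivative of the function `f` in the direction of the vector field `X`. -/
def dirDeriv (X : Π p : M, Tan n p) (f : M → ℝ) (p : M) : ℝ :=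
  mvfderiv (𝓡 n) f p (X p)

/-- The Lie bracket of vector fields. -/
abbrev lie (X Y : Π p : M, Tan n p) : Π p : M, Tan n p :=
  mlieBracket (𝓡 n) X Y

variable [IsManifold (𝓡 n) ∞ M]

/-- The vector field `X` is smooth. -/
def SmoothVF (X : Π p : M, Tan n p) : Prop :=
  ContMDiff (𝓡 n) ((𝓡 n).prod 𝓘(ℝ, EuclideanSpace ℝ (Fin n))) ∞
    (fun p => TotalSpace.mk' (EuclideanSpace ℝ (Fin n)) (E := TangentSpace (𝓡 n)) p (X p))

/-- The one-form `ξ` is smooth, as a section of the cotangent bundle. -/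
def SmoothForm (ξ : Π p : M, Cotan n p) : Prop :=
  ContMDiff (𝓡 n) ((𝓡 n).prod 𝓘(ℝ, EuclideanSpace ℝ (Fin n) →L[ℝ] ℝ)) ∞
    (fun p => TotalSpace.mk' (EuclideanSpace ℝ (Fin n) →L[ℝ] ℝ)
      (E := fun p : M => (TangentSpace (𝓡 n) p →L[ℝ] ℝ)) p (ξ p))

/-- The vector field `X` is differentiable at `p`. -/
def DiffVFAt (X : Π p : M, Tan n p) (p : M) : Prop :=
  MDifferentiableAt (𝓡 n) ((𝓡 n).prod 𝓘(ℝ, EuclideanSpace ℝ (Fin n)))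
    (fun p => TotalSpace.mk' (EuclideanSpace ℝ (Fin n)) (E := TangentSpace (𝓡 n)) p (X p)) p

/-- The one-form `ξ` is differentiable at `p`. -/
def DiffFormAt (ξ : Π p : M, Cotan n p) (p : M) : Prop :=
  MDifferentiableAt (𝓡 n) ((𝓡 n).prod 𝓘(ℝ, EuclideanSpace ℝ (Fin n) →L[ℝ] ℝ))
    (fun p => TotalSpace.mk' (EuclideanSpace ℝ (Fin n) →L[ℝ] ℝ)
      (E := fun p : M => (TangentSpace (𝓡 n) p →L[ℝ] ℝ)) p (ξ p)) p

theorem DiffFormAt.apply {ξ : Π p : M, Cotan n p} {p : M}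
    (hξ : DiffFormAt ξ p) {X : Π p : M, Tan n p} (hX : DiffVFAt X p) :
    MDifferentiableAt (𝓡 n) 𝓘(ℝ, ℝ) (fun q => ξ q (X q)) p := by
  have : MDifferentiableAt (𝓡 n) ((𝓡 n).prod 𝓘(ℝ, ℝ))
      (fun q => TotalSpace.mk' ℝ (E := Bundle.Trivial M ℝ) q (ξ q (X q))) p :=
    MDifferentiableAt.clm_bundle_apply (F₁ := EuclideanSpace ℝ (Fin n)) (F₂ := ℝ)
      (E₂ := Bundle.Trivial M ℝ) hξ hX
  simp only [mdifferentiableAt_totalSpace] at this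
  exact this.2

theorem SmoothVF.diffAt {X : Π p : M, Tan n p} (hX : SmoothVF X) (p : M) : DiffVFAt X p :=
  (hX p).mdifferentiableAt (by simp)

theorem SmoothForm.diffAt {ξ : Π p : M, Cotan n p} (hξ : SmoothForm ξ) (p : M) :
    DiffFormAt ξ p :=
  (hξ p).mdifferentiableAt (by simp)

/-- `dξ(X, Y) = X(ξ(Y)) - Y(ξ(X)) - ξ([X, Y])`, as an operation on vector fields. -/
def koszulForm (ξ : Π p : M, Cotan n p) (p : M) (X Y : Π p : M, Tan n p) : ℝ :=
  dirDeriv X (fun q => ξ q (Y q)) p - dirDeriv Y (fun q => ξ q (X q)) p - ξ p (lie X Y p)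

/-- `(ℒ_X ξ)(Z) = X(ξ(Z)) - ξ([X, Z])`, as an operation on vector fields. -/
def koszulLie (X : Π p : M, Tan n p) (ξ : Π p : M, Cotan n p) (p : M)
    (Z : Π p : M, Tan n p) : ℝ :=
  dirDeriv X (fun q => ξ q (Z q)) p - ξ p (lie X Z p)

theorem koszulLie_tensorial (X : Π p : M, Tan n p) {ξ : Π p : M, Cotan n p} {p : M}
    (hξ : DiffFormAt ξ p) :
    TensorialAt (𝓡 n) (EuclideanSpace ℝ (Fin n)) (koszulLie X ξ p) p where
  smul {f Z} hf hZ := by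
    have h1 := hξ.apply hZ
    have h2 : (fun q => ξ q ((f • Z) q)) = fun q => f q * ξ q (Z q) := by
      funext q; simp
    simp only [koszulLie, dirDeriv, lie, h2, mvfderiv_fun_mul hf h1, mlieBracket_smul_right hf hZ]
    simp
    ring
  add {Z Z'} hZ hZ' := by
    have h2 : (fun q => ξ q ((Z + Z') q)) = fun q => ξ q (Z q) + ξ q (Z' q) := by
      funext q; simp
    simp only [koszulLie, dirDeriv, lie, h2, mvfderiv_fun_add (hξ.apply hZ) (hξ.apply hZ'),
      mlieBracket_add_right hZ hZ']
    simp
    ring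

theorem koszulForm_tensorial_right (X : Π p : M, Tan n p)
    {ξ : Π p : M, Cotan n p} {p : M} (hξ : DiffFormAt ξ p) :
    TensorialAt (𝓡 n) (EuclideanSpace ℝ (Fin n)) (koszulForm ξ p X) p where
  smul {f Z} hf hZ := by
    have h1 := hξ.apply hZ
    have h2 : (fun q => ξ q ((f • Z) q)) = fun q => f q * ξ q (Z q) := by
      funext q; simp
    simp only [koszulForm, dirDeriv, lie, h2, mvfderiv_fun_mul hf h1, mlieBracket_smul_right hf hZ]
    simp
    ring
  add {Z Z'} hZ hZ' := by
    have h2 : (fun q => ξ q ((Z + Z') q)) = fun q => ξ q (Z q) + ξ q (Z' q) := by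
      funext q; simp
    simp only [koszulForm, dirDeriv, lie, h2, mvfderiv_fun_add (hξ.apply hZ) (hξ.apply hZ'),
      mlieBracket_add_right hZ hZ']
    simp
    ring

theorem koszulForm_tensorial_left (Y : Π p : M, Tan n p)
    {ξ : Π p : M, Cotan n p} {p : M} (hξ : DiffFormAt ξ p) :
    TensorialAt (𝓡 n) (EuclideanSpace ℝ (Fin n)) (fun X => koszulForm ξ p X Y) p := by
  have h : (fun X => koszulForm ξ p X Y) = fun X => - koszulForm ξ p Y X := by
    funext X
    simp only [koszulForm, lie, mlieBracket_swap_apply (V := X)]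
    simp
    ring
  have h' := koszulForm_tensorial_right Y hξ
  rw [h]
  exact ⟨fun hf hX => by rw [h'.smul hf hX]; simp,
    fun hX hX' => by rw [h'.add hX hX']; ring⟩

open Classical in
/-- The Lie derivative `ℒ_X ξ` of a one-form; the junk value `0` at a point where `ξ` is not
differentiable. -/
def lieDerivForm (X : Π p : M, Tan n p) (ξ : Π p : M, Cotan n p) (p : M) : Cotan n p :=
  if h : DiffFormAt ξ p then TensorialAt.mkHom (koszulLie X ξ p) p (koszulLie_tensorial X h) else 0

open Classical in
/-- The exterior derivative `dξ` of a one-form, a bilinear form on each tangent space; the junk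
value `0` at a point where `ξ` is not differentiable. -/
def extDerivForm (ξ : Π p : M, Cotan n p) (p : M) : Tan n p →L[ℝ] Tan n p →L[ℝ] ℝ :=
  if h : DiffFormAt ξ p then
    TensorialAt.mkHom₂ (koszulForm ξ p) p (fun Y _ => koszulForm_tensorial_left Y h)
      (fun X _ => koszulForm_tensorial_right X h)
  else 0

theorem lieDerivForm_apply (X : Π p : M, Tan n p) {ξ : Π p : M, Cotan n p} {p : M}
    (hξ : DiffFormAt ξ p) {Z : Π p : M, Tan n p} (hZ : DiffVFAt Z p) :
    lieDerivForm X ξ p (Z p) = dirDeriv X (fun q => ξ q (Z q)) p - ξ p (lie X Z p) := by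
  rw [lieDerivForm, dif_pos hξ]
  exact TensorialAt.mkHom_apply _ hZ

theorem extDerivForm_apply {ξ : Π p : M, Cotan n p} {p : M} (hξ : DiffFormAt ξ p)
    {X Y : Π p : M, Tan n p} (hX : DiffVFAt X p) (hY : DiffVFAt Y p) :
    extDerivForm ξ p (X p) (Y p) =
      dirDeriv X (fun q => ξ q (Y q)) p - dirDeriv Y (fun q => ξ q (X q)) p - ξ p (lie X Y p) := by
  rw [extDerivForm, dif_pos hξ]
  exact TensorialAt.mkHom₂_apply _ _ hX hY

/-- A field of bilinear forms on the tangent spaces is smooth if its contraction with every smooth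
vector field is a smooth one-form. -/
def SmoothBilin (B : Π p : M, Tan n p →L[ℝ] Tan n p →L[ℝ] ℝ) : Prop :=
  ∀ X, SmoothVF X → SmoothForm (fun p => B p (X p))

/-- A field of trilinear forms on the tangent spaces is smooth if its contraction with every smooth
vector field is a smooth field of bilinear forms. -/
def SmoothTrilin (T : Π p : M, Tan n p →L[ℝ] Tan n p →L[ℝ] Tan n p →L[ℝ] ℝ) : Prop :=
  ∀ X, SmoothVF X → SmoothBilin (fun p => T p (X p))

/-- A field of endomorphisms of the tangent spaces is smooth if it maps smooth vector fields to
smooth vector fields. -/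
def SmoothEnd (J : Π p : M, Tan n p →ₗ[ℝ] Tan n p) : Prop :=
  ∀ X, SmoothVF X → SmoothVF (fun p => J p (X p))

/-- The exterior derivative of a two-form, evaluated on vector fields. -/
def extDeriv₂ (F : Π p : M, Tan n p →L[ℝ] Tan n p →L[ℝ] ℝ) (X Y Z : Π p : M, Tan n p)
    (p : M) : ℝ :=
  dirDeriv X (fun q => F q (Y q) (Z q)) p - dirDeriv Y (fun q => F q (X q) (Z q)) p
    + dirDeriv Z (fun q => F q (X q) (Y q)) p
    - F p (lie X Y p) (Z p) + F p (lie X Z p) (Y p) - F p (lie Y Z p) (X p)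

/-- The exterior derivative of a three-form, evaluated on vector fields. -/
def extDeriv₃ (H : Π p : M, Tan n p →L[ℝ] Tan n p →L[ℝ] Tan n p →L[ℝ] ℝ)
    (X Y Z W : Π p : M, Tan n p) (p : M) : ℝ :=
  dirDeriv X (fun q => H q (Y q) (Z q) (W q)) p - dirDeriv Y (fun q => H q (X q) (Z q) (W q)) p
    + dirDeriv Z (fun q => H q (X q) (Y q) (W q)) p - dirDeriv W (fun q => H q (X q) (Y q) (Z q)) p
    - H p (lie X Y p) (Z p) (W p) + H p (lie X Z p) (Y p) (W p) - H p (lie X W p) (Y p) (Z p)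
    - H p (lie Y Z p) (X p) (W p) + H p (lie Y W p) (X p) (Z p) - H p (lie Z W p) (X p) (Y p)

/-- The four-form `F ∧ F`. -/
def wedgeSq (F : Π p : M, Tan n p →L[ℝ] Tan n p →L[ℝ] ℝ) (p : M) (v w x y : Tan n p) : ℝ :=
  2 * (F p v w * F p x y - F p v x * F p w y + F p v y * F p w x)

end Calculus

section Courant

/-- A pair `(H, F)` of a smooth three-form and a smooth two-form with `dF = 0` and
`dH = - F ∧ F`. -/
structure Twist (n : ℕ) (M : Type*) [TopologicalSpace M]
    [ChartedSpace (EuclideanSpace ℝ (Fin n)) M] [IsManifold (𝓡 n) ∞ M] where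
  H : Π p : M, Tan n p →L[ℝ] Tan n p →L[ℝ] Tan n p →L[ℝ] ℝ
  F : Π p : M, Tan n p →L[ℝ] Tan n p →L[ℝ] ℝ
  smooth_H : SmoothTrilin H
  smooth_F : SmoothBilin F
  alt_H : ∀ p v w, H p v v w = 0 ∧ H p v w w = 0
  alt_F : ∀ p v, F p v v = 0
  dF : ∀ X Y Z, SmoothVF X → SmoothVF Y → SmoothVF Z → ∀ p, extDeriv₂ F X Y Z p = 0
  dH : ∀ X Y Z W, SmoothVF X → SmoothVF Y → SmoothVF Z → SmoothVF W → ∀ p,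
    extDeriv₃ H X Y Z W p = - wedgeSq F p (X p) (Y p) (Z p) (W p)

variable {n : ℕ} {M : Type*} [TopologicalSpace M] [ChartedSpace (EuclideanSpace ℝ (Fin n)) M]

/-- The fibre at `p` of `E = TM ⊕ T^*M ⊕ ℝ`. -/
abbrev Fib (n : ℕ) {M : Type*} [TopologicalSpace M] [ChartedSpace (EuclideanSpace ℝ (Fin n)) M]
    (p : M) : Type :=
  Tan n p × Cotan n p × ℝ

instance instFiniteDimensionalTan (p : M) :
    FiniteDimensional ℝ (Tan n p) :=
  inferInstanceAs (FiniteDimensional ℝ (EuclideanSpace ℝ (Fin n)))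

instance instT2SpaceTan (p : M) : T2Space (Tan n p) :=
  inferInstanceAs (T2Space (EuclideanSpace ℝ (Fin n)))

/-- The scalar product `⟨X + ξ + λ, Y + η + μ⟩ = (η(X) + ξ(Y)) / 2 + λ μ` on the fibres of `E`. -/
def scalar (p : M) : LinearMap.BilinForm ℝ (Fib n p) :=
  LinearMap.mk₂ ℝ (fun u v => (v.2.1 u.1 + u.2.1 v.1) / 2 + u.2.2 * v.2.2)
    (fun u u' v => by simp; ring) (fun c u v => by simp; ring)
    (fun u v v' => by simp; ring) (fun c u v => by simp; ring)

variable [IsManifold (𝓡 n) ∞ M]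

/-- The section `u` of `E` is smooth. -/
def SmoothSec (u : Π p : M, Fib n p) : Prop :=
  SmoothVF (fun p => (u p).1) ∧ SmoothForm (fun p => (u p).2.1) ∧
    ContMDiff (𝓡 n) 𝓘(ℝ, ℝ) ∞ (fun p => (u p).2.2)

/-- The Dorfman bracket on sections of `E`, twisted by `(H, F)`. For `u = X + ξ + λ` and
`v = Y + η + μ` its three components are `[X, Y]`,
`ℒ_X η - i_Y dξ + 2 μ dλ + i_X i_Y H - 2 (μ i_X F - λ i_Y F)`, and `X(μ) - Y(λ) + F(X, Y)`. -/
def dorfman (T : Twist n M) (u v : Π p : M, Fib n p) (p : M) : Fib n p :=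
  let X : Π p : M, Tan n p := fun q => (u q).1
  let ξ : Π p : M, Cotan n p := fun q => (u q).2.1
  let l : M → ℝ := fun q => (u q).2.2
  let Y : Π p : M, Tan n p := fun q => (v q).1
  let η : Π p : M, Cotan n p := fun q => (v q).2.1
  let m : M → ℝ := fun q => (v q).2.2
  (lie X Y p,
   lieDerivForm X η p - extDerivForm ξ p (Y p) + (2 * m p) • mvfderiv (𝓡 n) l p
     + T.H p (Y p) (X p) - (2 : ℝ) • (m p • T.F p (X p) - l p • T.F p (Y p)),
   dirDeriv X m p - dirDeriv Y l p + T.F p (X p) (Y p))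

/-- A field of endomorphisms of the fibres of `E` is smooth if it maps smooth sections to smooth
sections. -/
def SmoothEndE (A : Π p : M, Fib n p →ₗ[ℝ] Fib n p) : Prop :=
  ∀ u, SmoothSec u → SmoothSec (fun p => A p (u p))

/-! ### Complex structures on `E` -/

/-- The eigenspace of (the complex linear extension of) `A` at `p` for the eigenvalue `c`, a complex
subspace of the complexification `ℂ ⊗ E_p`. -/
def eigen (A : Π p : M, Fib n p →ₗ[ℝ] Fib n p) (c : ℂ) (p : M) : Submodule ℂ (ℂ ⊗[ℝ] Fib n p) :=
  Module.End.eigenspace ((A p).baseChange ℂ) c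

/-- `A` is a `B_n`-generalized almost complex structure: its `i`-eigenbundle `L` is an isotropic
subbundle of rank `n` of the complexification of `E` (with respect to the complex bilinear extension
of the scalar product), and `A` vanishes on the orthogonal complement of `L ⊕ L̄`. As `A` is real,
`L̄` is its `(-i)`-eigenbundle, and `L ∩ L̄ = 0`. -/
structure IsAlmostComplex (A : Π p : M, Fib n p →ₗ[ℝ] Fib n p) : Prop where
  smooth : SmoothEndE A
  isotropic : ∀ p, ∀ x ∈ eigen A Complex.I p, ∀ y ∈ eigen A Complex.I p,
    (scalar p).baseChange ℂ x y = 0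
  rank : ∀ p, Module.finrank ℂ (eigen A Complex.I p) = n
  ker : ∀ p (x : ℂ ⊗[ℝ] Fib n p),
    (∀ y ∈ eigen A Complex.I p ⊔ eigen A (-Complex.I) p, (scalar p).baseChange ℂ y x = 0) →
      (A p).baseChange ℂ x = 0

/-- The section `a + i b` of the complexification of `E` determined by real sections `a`, `b`. -/
def cplx (a b : Π p : M, Fib n p) (p : M) : ℂ ⊗[ℝ] Fib n p :=
  (1 : ℂ) ⊗ₜ[ℝ] a p + Complex.I ⊗ₜ[ℝ] b p

/-- The family of complex subspaces `L` is integrable: the smooth sections of the complexification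
of `E` with values in `L` are closed under the complex bilinear extension
`[a + i b, c + i d] = ([a, c] - [b, d]) + i ([a, d] + [b, c])` of the Dorfman bracket. -/
def IsIntegrable (T : Twist n M) (L : Π p : M, Submodule ℂ (ℂ ⊗[ℝ] Fib n p)) : Prop :=
  ∀ a b c d : Π p : M, Fib n p, SmoothSec a → SmoothSec b → SmoothSec c → SmoothSec d →
    (∀ p, cplx a b p ∈ L p) → (∀ p, cplx c d p ∈ L p) →
    ∀ p, cplx (dorfman T a c - dorfman T b d) (dorfman T a d + dorfman T b c) p ∈ L p

/-- `A` is a `B_n`-generalized complex structure. -/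
def IsGenComplex (T : Twist n M) (A : Π p : M, Fib n p →ₗ[ℝ] Fib n p) : Prop :=
  IsAlmostComplex A ∧ IsIntegrable T (eigen A Complex.I)

/-! ### Generalized metrics -/

/-- An (admissible) generalized metric: a subbundle `E₋ ⊂ E` which the anchor `E → TM` maps
isomorphically onto `TM`, and on which the scalar product is non-degenerate. Such a subbundle is the
same thing as the image of a smooth splitting `s(X) = X + σ(X) + A(X)` of the anchor. -/
structure GenMetric (n : ℕ) (M : Type*) [TopologicalSpace M]
    [ChartedSpace (EuclideanSpace ℝ (Fin n)) M] [IsManifold (𝓡 n) ∞ M] where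
  Eminus : Π p : M, Submodule ℝ (Fib n p)
  σ : Π p : M, Tan n p →L[ℝ] Tan n p →L[ℝ] ℝ
  A : Π p : M, Cotan n p
  smooth_σ : SmoothBilin σ
  smooth_A : SmoothForm A
  mem_iff : ∀ p e, e ∈ Eminus p ↔ e.2.1 = σ p e.1 ∧ e.2.2 = A p e.1
  nondegenerate : ∀ p, ((scalar p).restrict (Eminus p)).Nondegenerate

namespace GenMetric

variable (G : GenMetric n M)

/-- `E₊`, the orthogonal complement of `E₋`. -/
def Eplus (p : M) : Submodule ℝ (Fib n p) :=
  (scalar p).orthogonal (G.Eminus p)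

theorem isCompl (p : M) : IsCompl (G.Eplus p) (G.Eminus p) := by
  refine (LinearMap.BilinForm.isCompl_orthogonal_of_restrict_nondegenerate ?_
    (G.nondegenerate p)).symm
  intro u v h
  simp only [scalar, LinearMap.mk₂_apply] at h ⊢
  linarith

/-- The endomorphism of `E` which is `± Id` on `E_±`. -/
def endo (p : M) : Fib n p →ₗ[ℝ] Fib n p :=
  (G.Eplus p).projection (G.Eminus p) (G.isCompl p) - (G.Eminus p).projection (G.Eplus p) (G.isCompl p).symm

/-- The inverse `s : TM → E₋` of the restriction of the anchor to `E₋`. -/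
def s (p : M) : Tan n p →ₗ[ℝ] Fib n p :=
  LinearMap.prod LinearMap.id (LinearMap.prod (G.σ p).toLinearMap (G.A p).toLinearMap)

/-- The pseudo-Riemannian metric `g(X, Y) = - ⟨s(X), s(Y)⟩`. -/
def g (p : M) : LinearMap.BilinForm ℝ (Tan n p) :=
  - (scalar p).compl₁₂ (G.s p) (G.s p)

/-- The lift `s₊(X) = s(X) + 2 i_X g` of `X` to `E₊`. When `E₋ = {X - i_X g}` is in the standard
form, `s(X) = X - i_X g` and `s₊(X) = X + i_X g`. -/
def sPlus (p : M) : Tan n p →ₗ[ℝ] Fib n p :=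
  G.s p + (2 : ℝ) • (LinearMap.inr ℝ (Tan n p) (Cotan n p × ℝ) ∘ₗ
    LinearMap.inl ℝ (Cotan n p) ℝ ∘ₗ LinearMap.toContinuousLinearMap.toLinearMap ∘ₗ G.g p)

/-- The unit section `e = 1 - 2 A` of the line bundle `E₊ ∩ (T^*M ⊕ ℝ)`, so that
`E₊ = {s₊(X) + a e}` is identified with `TM ⊕ ℝ`. In the standard form, `e = 1`. -/
def unitPlus (p : M) : Fib n p :=
  (0, (-2 : ℝ) • G.A p, 1)

end GenMetric

/-! ### Generalized pseudo-Kähler structures and their components -/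

/-- `(G, Φ)` is a `B_n`-generalized almost pseudo-Hermitian structure. -/
def IsAlmostPseudoHermitian (G : GenMetric n M) (Φ : Π p : M, Fib n p →ₗ[ℝ] Fib n p) : Prop :=
  IsAlmostComplex Φ ∧ ∀ p, G.endo p ∘ₗ Φ p = Φ p ∘ₗ G.endo p

/-- `(G, Φ)` is a `B_n`-generalized pseudo-Kähler structure on `E` with the Dorfman bracket twisted
by `T`. -/
def IsPseudoKahler (T : Twist n M) (G : GenMetric n M) (Φ : Π p : M, Fib n p →ₗ[ℝ] Fib n p) :
    Prop :=
  IsAlmostPseudoHermitian G Φ ∧ IsGenComplex T Φ ∧ IsGenComplex T (fun p => G.endo p ∘ₗ Φ p)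

/-- `u` is a smooth section of `Ker Φ` with `⟨u, u⟩ = (-1)^n` (it is unique up to sign). -/
structure IsUnitKernelSection (Φ : Π p : M, Fib n p →ₗ[ℝ] Fib n p) (u : Π p : M, Fib n p) :
    Prop where
  smooth : SmoothSec u
  ker : ∀ p, Φ p (u p) = 0
  unit : ∀ p, scalar p (u p) (u p) = (-1) ^ n

/-- For `n` odd, the component `X₋`: the image under the anchor of the unit section `u` of `Ker Φ`,
which lies in `E₋`. -/
def compXminus (u : Π p : M, Fib n p) (p : M) : Tan n p :=
  (u p).1

/-- The component `J₋`: the endomorphism of `TM` corresponding to the restriction of `Φ` to `E₋`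
under the identification `s : TM → E₋`. -/
def compJminus (G : GenMetric n M) (Φ : Π p : M, Fib n p →ₗ[ℝ] Fib n p) (p : M) :
    Tan n p →ₗ[ℝ] Tan n p :=
  LinearMap.fst ℝ (Tan n p) (Cotan n p × ℝ) ∘ₗ Φ p ∘ₗ G.s p

/-- For `n` odd, the component `X₊`: the restriction of `Φ` to `E₊`, regarded as an endomorphism of
`TM ⊕ ℝ`, is `Y + a ↦ (J₊ Y + a X₊) - g(X₊, Y)`. -/
def compXplus (G : GenMetric n M) (Φ : Π p : M, Fib n p →ₗ[ℝ] Fib n p) (p : M) : Tan n p :=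
  (Φ p (G.unitPlus p)).1

/-- The component `J₊`: the restriction of `Φ` to `E₊`, regarded as an endomorphism of
`TM ⊕ ℝ`, is `Y + a ↦ (J₊ Y + a X₊) - g(X₊, Y)`. -/
def compJplus (G : GenMetric n M) (Φ : Π p : M, Fib n p →ₗ[ℝ] Fib n p) (p : M) :
    Tan n p →ₗ[ℝ] Tan n p :=
  LinearMap.fst ℝ (Tan n p) (Cotan n p × ℝ) ∘ₗ Φ p ∘ₗ G.sPlus p

/-- `X` is a (smooth) Killing field of the metric `g`, that is `ℒ_X g = 0`. -/
def IsKilling (g : Π p : M, LinearMap.BilinForm ℝ (Tan n p)) (X : Π p : M, Tan n p) : Prop :=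
  SmoothVF X ∧ ∀ Y Z, SmoothVF Y → SmoothVF Z →
    ContMDiff (𝓡 n) 𝓘(ℝ, ℝ) ∞ (fun q => g q (Y q) (Z q)) ∧
    ∀ p, dirDeriv X (fun q => g q (Y q) (Z q)) p
      = g p (lie X Y p) (Z p) + g p (Y p) (lie X Z p)

/-- The smooth vector fields `X` and `Y` commute. -/
def VFCommute (X Y : Π p : M, Tan n p) : Prop :=
  SmoothVF X ∧ SmoothVF Y ∧ ∀ p, lie X Y p = 0

/-- The smooth vector field `X` preserves the smooth endomorphism field `J`, that is `ℒ_X J = 0`. -/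
def PreservesEnd (X : Π p : M, Tan n p) (J : Π p : M, Tan n p →ₗ[ℝ] Tan n p) : Prop :=
  SmoothVF X ∧ SmoothEnd J ∧ ∀ Y, SmoothVF Y → ∀ p,
    lie X (fun q => J q (Y q)) p = J p (lie X Y p)

end Courant

end BnGeom

end

open BnGeom

/-! Write `[u, ·]` for the Dorfman bracket with the unit kernel section `u`. The point is that `[u,
·]` is an infinitesimal symmetry of the whole structure: it commutes with `Φ` and preserves both
`E₊` and `E₋`. All four claims are then read off through the anchor, which sends `[u, ·]` to the Lie
derivative along `X₋`.

Only two Courant algebroid axioms are needed, not the Jacobi identity: the bracket preserves the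
scalar product (`dirDeriv_scalar_eq_dorfman`), and its symmetric part is the differential of the
scalar product (`scalar_dorfman_add_dorfman`). They give `⟨[u, v], w⟩ = ⟨u, [v, w]⟩` for `v`, `w`
orthogonal to `u`. The sections `Φ²v + iΦv` lie in `L`, and integrability puts the imaginary part of
the bracket of two of them in the image of `Φ`, which is orthogonal to `u`. This yields `[u, Φ²v] =
Φ[u, Φv]`, and transposing with respect to the scalar product gives `[u, Φv] = Φ[u, v]`
(`IsGenComplex.dorfman_apply`).

The second structure `GΦ` has the same kernel, so `[u, ·]` commutes with it too, and comparing the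
two shows that `E_±` are preserved (`IsPseudoKahler.endo_dorfman`); this uses that `u` lies in `E₋`,
which is where odd `n` enters. Hence `[u, s(X)] = s([X₋, X])`, `[u, s₊(X)] = s₊([X₋, X])` and `[u,
e] = 0`. -/

namespace BnGeom

/-! ### Real linear algebra of the `± i`-eigenspaces -/

section LinearAlgebra

variable {V : Type*} [AddCommGroup V] [Module ℝ V]

theorem one_tmul_add_I_tmul_inj {a b c d : V}
    (h : (1 : ℂ) ⊗ₜ[ℝ] a + Complex.I ⊗ₜ[ℝ] b = (1 : ℂ) ⊗ₜ[ℝ] c + Complex.I ⊗ₜ[ℝ] d) :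
    a = c ∧ b = d := by
  have h1 := congrArg (fun x => TensorProduct.lid ℝ V (LinearMap.rTensor V Complex.reLm x)) h
  have h2 := congrArg (fun x => TensorProduct.lid ℝ V (LinearMap.rTensor V Complex.imLm x)) h
  simp at h1 h2
  exact ⟨h1, h2⟩

theorem exists_one_tmul_add_I_tmul (x : ℂ ⊗[ℝ] V) :
    ∃ a b : V, x = (1 : ℂ) ⊗ₜ[ℝ] a + Complex.I ⊗ₜ[ℝ] b := by
  induction x with
  | zero => exact ⟨0, 0, by simp⟩
  | tmul z v =>
    refine ⟨z.re • v, z.im • v, ?_⟩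
    rw [← TensorProduct.smul_tmul, ← TensorProduct.smul_tmul, ← TensorProduct.add_tmul]
    congr 1
    apply Complex.ext <;> simp
  | add x y hx hy =>
    obtain ⟨a, b, rfl⟩ := hx
    obtain ⟨c, d, rfl⟩ := hy
    exact ⟨a + c, b + d, by simp only [TensorProduct.tmul_add]; abel⟩

theorem mem_eigenspace_baseChange_iff (A : V →ₗ[ℝ] V) (a b : V) {ε : ℝ} :
    (1 : ℂ) ⊗ₜ[ℝ] a + Complex.I ⊗ₜ[ℝ] b ∈
      Module.End.eigenspace (A.baseChange ℂ) (ε * Complex.I) ↔ A a = -ε • b ∧ A b = ε • a := by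
  have key : (ε * Complex.I : ℂ) • ((1 : ℂ) ⊗ₜ[ℝ] a + Complex.I ⊗ₜ[ℝ] b) =
      (1 : ℂ) ⊗ₜ[ℝ] (-ε • b) + Complex.I ⊗ₜ[ℝ] (ε • a) := by
    rw [← TensorProduct.smul_tmul, ← TensorProduct.smul_tmul]
    simp only [smul_add, TensorProduct.smul_tmul', smul_eq_mul, mul_one]
    rw [add_comm]
    congr 2
    all_goals apply Complex.ext <;> simp
  rw [Module.End.mem_eigenspace_iff, key]
  simp only [map_add, LinearMap.baseChange_tmul]
  exact ⟨one_tmul_add_I_tmul_inj, fun ⟨h1, h2⟩ => by rw [h1, h2]⟩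

theorem mem_eigenspace_I_iff (A : V →ₗ[ℝ] V) (a b : V) :
    (1 : ℂ) ⊗ₜ[ℝ] a + Complex.I ⊗ₜ[ℝ] b ∈ Module.End.eigenspace (A.baseChange ℂ) Complex.I ↔
      A a = -b ∧ A b = a := by
  simpa using mem_eigenspace_baseChange_iff A a b (ε := 1)

theorem mem_eigenspace_neg_I_iff (A : V →ₗ[ℝ] V) (a b : V) :
    (1 : ℂ) ⊗ₜ[ℝ] a + Complex.I ⊗ₜ[ℝ] b ∈ Module.End.eigenspace (A.baseChange ℂ) (-Complex.I) ↔
      A a = b ∧ A b = -a := by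
  simpa using mem_eigenspace_baseChange_iff A a b (ε := -1)

theorem baseChange_one_tmul_add_I_tmul (B : LinearMap.BilinForm ℝ V) (a b c d : V) :
    B.baseChange ℂ ((1 : ℂ) ⊗ₜ[ℝ] a + Complex.I ⊗ₜ[ℝ] b) ((1 : ℂ) ⊗ₜ[ℝ] c + Complex.I ⊗ₜ[ℝ] d) =
      ⟨B a c - B b d, B a d + B b c⟩ := by
  simp only [map_add, LinearMap.add_apply, LinearMap.BilinForm.baseChange_tmul]
  apply Complex.ext <;> simp <;> ring

/-- The subspace on which `A² = -1`, the real form of the sum of the `± i`-eigenspaces of `A`. -/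
def sqNegOne (A : V →ₗ[ℝ] V) : Submodule ℝ V := LinearMap.ker (A ∘ₗ A + LinearMap.id)

theorem mem_sqNegOne {A : V →ₗ[ℝ] V} {x : V} : x ∈ sqNegOne A ↔ A (A x) = -x := by
  simp [sqNegOne, add_eq_zero_iff_eq_neg]

theorem apply_mem_sqNegOne {A : V →ₗ[ℝ] V} {x : V} (hx : x ∈ sqNegOne A) : A x ∈ sqNegOne A := by
  rw [mem_sqNegOne] at *
  simp [hx]

/-- The map `b ↦ A b + i b` is a real isomorphism from the real form onto the `i`-eigenspace. -/
theorem finrank_sqNegOne (A : V →ₗ[ℝ] V) :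
    Module.finrank ℝ (sqNegOne A) =
      2 * Module.finrank ℂ (Module.End.eigenspace (A.baseChange ℂ) Complex.I) := by
  rw [← finrank_real_of_complex]
  let f : sqNegOne A →ₗ[ℝ] Module.End.eigenspace (A.baseChange ℂ) Complex.I :=
    { toFun := fun b => ⟨(1 : ℂ) ⊗ₜ[ℝ] A b + Complex.I ⊗ₜ[ℝ] (b : V),
        (mem_eigenspace_I_iff A _ _).2 ⟨mem_sqNegOne.1 b.2, rfl⟩⟩
      map_add' := fun b c => by
        ext; simp only [Submodule.coe_add, map_add, TensorProduct.tmul_add]; abel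
      map_smul' := fun r b => by
        ext
        simp only [Submodule.coe_smul, map_smul, TensorProduct.tmul_smul, RingHom.id_apply]
        exact (smul_add r _ _).symm }
  refine LinearEquiv.finrank_eq (LinearEquiv.ofBijective f ⟨fun b c h => ?_, fun y => ?_⟩)
  · exact Subtype.ext (one_tmul_add_I_tmul_inj (congrArg Subtype.val h)).2
  · obtain ⟨y, hy⟩ := y
    obtain ⟨a, b, rfl⟩ := exists_one_tmul_add_I_tmul y
    obtain ⟨h1, h2⟩ := (mem_eigenspace_I_iff A _ _).1 hy
    exact ⟨⟨b, mem_sqNegOne.2 (by rw [h2, h1])⟩, Subtype.ext (by simp [f, h2])⟩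

variable {B : LinearMap.BilinForm ℝ V} {A : V →ₗ[ℝ] V}

/-- This is the imaginary part of the isotropy of `A x + i x` against `A y + i y`. -/
theorem isotropic_iff_real
    (h : ∀ x ∈ Module.End.eigenspace (A.baseChange ℂ) Complex.I,
      ∀ y ∈ Module.End.eigenspace (A.baseChange ℂ) Complex.I, B.baseChange ℂ x y = 0)
    {x y : V} (hx : x ∈ sqNegOne A) (hy : y ∈ sqNegOne A) : B (A x) y = - B x (A y) := by
  have := h _ ((mem_eigenspace_I_iff A _ _).2 ⟨mem_sqNegOne.1 hx, rfl⟩)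
    _ ((mem_eigenspace_I_iff A _ _).2 ⟨mem_sqNegOne.1 hy, rfl⟩)
  rw [baseChange_one_tmul_add_I_tmul] at this
  exact eq_neg_of_add_eq_zero_left (congrArg Complex.im this)

/-- Real and imaginary parts of eigenvectors for `± i` all satisfy `A² = -1`, so real orthogonality
to that subspace implies complex orthogonality to `L ⊕ L̄`. -/
theorem apply_eq_zero_of_orthogonal
    (h : ∀ x : ℂ ⊗[ℝ] V, (∀ y ∈ Module.End.eigenspace (A.baseChange ℂ) Complex.I ⊔
        Module.End.eigenspace (A.baseChange ℂ) (-Complex.I), B.baseChange ℂ y x = 0) →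
      A.baseChange ℂ x = 0)
    {x : V} (hx : ∀ w ∈ sqNegOne A, B w x = 0) : A x = 0 := by
  have := h ((1 : ℂ) ⊗ₜ[ℝ] x + Complex.I ⊗ₜ[ℝ] 0) fun y hy => ?_
  · simp only [map_add, LinearMap.baseChange_tmul] at this
    exact (one_tmul_add_I_tmul_inj (this.trans (b := 0) (c := (1 : ℂ) ⊗ₜ[ℝ] 0 + Complex.I ⊗ₜ[ℝ] 0)
      (by simp))).1
  · obtain ⟨y, hy', z, hz, rfl⟩ := Submodule.mem_sup.1 hy
    obtain ⟨a, b, rfl⟩ := exists_one_tmul_add_I_tmul y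
    obtain ⟨c, d, rfl⟩ := exists_one_tmul_add_I_tmul z
    obtain ⟨h1, h2⟩ := (mem_eigenspace_I_iff A _ _).1 hy'
    obtain ⟨h3, h4⟩ := (mem_eigenspace_neg_I_iff A _ _).1 hz
    have ha : a ∈ sqNegOne A := mem_sqNegOne.2 (by simp [h1, h2])
    have hb : b ∈ sqNegOne A := mem_sqNegOne.2 (by simp [h1, h2])
    have hc : c ∈ sqNegOne A := mem_sqNegOne.2 (by simp [h3, h4])
    have hd : d ∈ sqNegOne A := mem_sqNegOne.2 (by simp [h3, h4])
    rw [map_add (B.baseChange ℂ), LinearMap.add_apply, baseChange_one_tmul_add_I_tmul,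
      baseChange_one_tmul_add_I_tmul, hx a ha, hx b hb, hx c hc, hx d hd]
    apply Complex.ext <;> simp

/-- If `A` vanishes on the orthogonal complement of the subspace `A² = -1`, then the space is the
sum of the two. -/
theorem exists_decomposition [FiniteDimensional ℝ V] (hB : B.IsSymm)
    (hker : ∀ x : V, (∀ w ∈ sqNegOne A, B w x = 0) → A x = 0) (x : V) :
    ∃ w ∈ sqNegOne A, ∃ k, (∀ w ∈ sqNegOne A, B w k = 0) ∧ w + k = x := by
  have hc : IsCompl (sqNegOne A) (B.orthogonal (sqNegOne A)) := by
    refine LinearMap.BilinForm.isCompl_orthogonal_iff_disjoint hB.isRefl |>.2 ?_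
    -- On the intersection `A` vanishes and `A² = -1`, so the intersection is zero.
    rw [Submodule.disjoint_def]
    intro x hx hx'
    have := hker x fun w hw => hx' w hw
    rw [mem_sqNegOne, this] at hx
    simpa using hx.symm
  have : x ∈ sqNegOne A ⊔ B.orthogonal (sqNegOne A) := hc.sup_eq_top ▸ Submodule.mem_top
  obtain ⟨w, hw, k, hk, rfl⟩ := Submodule.mem_sup.1 this
  exact ⟨w, hw, k, hk, rfl⟩

/-- Isotropy gives skewness where `A² = -1`; the orthogonal complement is killed by `A` and
contributes nothing. -/
theorem skew_of_isotropic [FiniteDimensional ℝ V] (hB : B.IsSymm)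
    (hker : ∀ x : V, (∀ w ∈ sqNegOne A, B w x = 0) → A x = 0)
    (hiso : ∀ x ∈ sqNegOne A, ∀ y ∈ sqNegOne A, B (A x) y = - B x (A y)) (x y : V) :
    B (A x) y = - B x (A y) := by
  obtain ⟨w, hw, k, hk, rfl⟩ := exists_decomposition hB hker x
  obtain ⟨w', hw', k', hk', rfl⟩ := exists_decomposition hB hker y
  have h1 : B k (A w') = 0 := (hB.eq _ _).trans (hk _ (apply_mem_sqNegOne hw'))
  simp [hker k hk, hker k' hk', hiso w hw w' hw', hk' _ (apply_mem_sqNegOne hw), h1]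

theorem apply_apply_apply_eq_neg [FiniteDimensional ℝ V] (hB : B.IsSymm)
    (hker : ∀ x : V, (∀ w ∈ sqNegOne A, B w x = 0) → A x = 0) (x : V) :
    A (A (A x)) = - A x := by
  obtain ⟨w, hw, k, hk, rfl⟩ := exists_decomposition hB hker x
  simp [hker k hk, mem_sqNegOne.1 (apply_mem_sqNegOne hw)]

/-- The kernel of `A` is a complement of the subspace `A² = -1`, hence a line, and `u` is a nonzero
vector on it. -/
theorem eq_smul_of_apply_eq_zero [FiniteDimensional ℝ V] (hB : B.IsSymm)
    (hker : ∀ x : V, (∀ w ∈ sqNegOne A, B w x = 0) → A x = 0)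
    (hdim : Module.finrank ℝ V = Module.finrank ℝ (sqNegOne A) + 1)
    {u : V} (hu : A u = 0) (huu : B u u ≠ 0) {x : V} (hx : A x = 0) : ∃ c : ℝ, x = c • u := by
  have hc : IsCompl (sqNegOne A) (LinearMap.ker A) := by
    constructor
    · rw [Submodule.disjoint_def]
      intro y hy hy'
      rw [LinearMap.mem_ker] at hy'
      rw [mem_sqNegOne, hy'] at hy
      simpa using hy.symm
    · rw [codisjoint_iff, eq_top_iff]
      intro y _
      obtain ⟨w, hw, k, hk, rfl⟩ := exists_decomposition hB hker y
      exact Submodule.add_mem_sup hw (hker k hk)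
  have h1 : Module.finrank ℝ (LinearMap.ker A) = 1 := by
    have := Submodule.finrank_add_eq_of_isCompl hc
    omega
  have hu0 : (⟨u, hu⟩ : LinearMap.ker A) ≠ 0 := fun h => huu (by
    rw [show u = 0 from congrArg Subtype.val h]; simp)
  obtain ⟨c, hc⟩ := (finrank_eq_one_iff_of_nonzero' _ hu0).1 h1 ⟨x, hx⟩
  exact ⟨c, (congrArg Subtype.val hc).symm⟩

end LinearAlgebra

/-! ### Global smooth extensions and smoothness of one-forms -/

section Extension

variable {n : ℕ} {M : Type*} [TopologicalSpace M] [ChartedSpace (EuclideanSpace ℝ (Fin n)) M]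
  [IsManifold (𝓡 n) ∞ M]

open FiberBundle Topology in
/-- Every vector in a fibre of a smooth vector bundle extends to a global smooth section, which
agrees near the base point with the section that is constant in the preferred trivialization. -/
theorem exists_contMDiff_eventuallyEq_extend [T2Space M]
    {F : Type*} [NormedAddCommGroup F] [NormedSpace ℝ F]
    {V : M → Type*} [TopologicalSpace (TotalSpace F V)] [∀ x, AddCommGroup (V x)]
    [∀ x, Module ℝ (V x)] [∀ x, TopologicalSpace (V x)] [FiberBundle F V] [VectorBundle ℝ F V]
    [ContMDiffVectorBundle ∞ F V (𝓡 n)] {p : M} (v : V p) :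
    ∃ s : Π q, V q, ContMDiff (𝓡 n) ((𝓡 n).prod 𝓘(ℝ, F)) ∞ (fun q => TotalSpace.mk' F q (s q)) ∧
      ∀ᶠ q in 𝓝 p, s q = extend F v q := by
  obtain ⟨U, hU, hs⟩ := exists_contMDiffOn_extend (𝓡 n) F (k := ∞) v
  obtain ⟨U', hU'U, hU'o, hp⟩ := mem_nhds_iff.1 hU
  obtain ⟨f, hf⟩ := (SmoothBumpFunction.nhds_basis_tsupport (I := 𝓡 n) p).mem_iff.1
    (hU'o.mem_nhds hp)
  refine ⟨(f : M → ℝ) • extend F v, ContMDiffOn.smul_section_of_tsupport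
    f.contMDiff.contMDiffOn hU'o hf.2 (hs.mono hU'U), ?_⟩
  filter_upwards [f.eventuallyEq_one] with q hq
  simp [hq]

theorem exists_smoothVF_apply_eq [T2Space M] {p : M} (v : Tan n p) : ∃ X, SmoothVF X ∧ X p = v := by
  obtain ⟨s, hs, h⟩ := exists_contMDiff_eventuallyEq_extend (n := n)
    (F := EuclideanSpace ℝ (Fin n)) (V := fun q : M => TangentSpace (𝓡 n) q) v
  exact ⟨s, hs, by simpa using h.self_of_nhds⟩

theorem exists_smoothForm_apply_eq [T2Space M] {p : M} (v : Cotan n p) :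
    ∃ ξ, SmoothForm ξ ∧ ξ p = v := by
  obtain ⟨s, hs, h⟩ := exists_contMDiff_eventuallyEq_extend (n := n)
    (F := EuclideanSpace ℝ (Fin n) →L[ℝ] ℝ)
    (V := fun q : M => (TangentSpace (𝓡 n) q →L[ℝ] ℝ)) v
  exact ⟨s, hs, by simpa using h.self_of_nhds⟩

theorem SmoothForm.contMDiff_apply {ξ : Π p : M, Cotan n p} (hξ : SmoothForm ξ)
    {X : Π p : M, Tan n p} (hX : SmoothVF X) : ContMDiff (𝓡 n) 𝓘(ℝ, ℝ) ∞ fun p => ξ p (X p) := by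
  intro p
  have : ContMDiffAt (𝓡 n) ((𝓡 n).prod 𝓘(ℝ, ℝ)) ∞
      (fun q => TotalSpace.mk' ℝ (E := Bundle.Trivial M ℝ) q (ξ q (X q))) p :=
    ContMDiffAt.clm_bundle_apply (F₁ := EuclideanSpace ℝ (Fin n)) (F₂ := ℝ)
      (E₂ := Bundle.Trivial M ℝ) (hξ p) (hX p)
  rw [contMDiffAt_totalSpace] at this
  exact this.2

/-- A field of covectors is smooth if its values on smooth vector fields are smooth. -/
theorem smoothForm_of_contMDiff_apply [T2Space M] {ξ : Π p : M, Cotan n p}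
    (h : ∀ X, SmoothVF X → ContMDiff (𝓡 n) 𝓘(ℝ, ℝ) ∞ fun p => ξ p (X p)) : SmoothForm ξ := by
  intro p
  rw [contMDiffAt_hom_bundle]
  refine ⟨contMDiffAt_id, ?_⟩
  set t := trivializationAt (EuclideanSpace ℝ (Fin n)) (TangentSpace (𝓡 n) (M := M)) p with ht
  have hp : p ∈ t.baseSet := FiberBundle.mem_baseSet_trivializationAt' p
  -- The coordinates of `ξ` are its values on the local frame of the trivialization. Near `p` each
  -- frame field agrees with a global smooth vector field, to which the hypothesis applies.
  have key (w : EuclideanSpace ℝ (Fin n)) :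
      ContMDiffAt (𝓡 n) 𝓘(ℝ, ℝ) ∞ (fun q => ξ q (t.symm q w)) p := by
    obtain ⟨X, hX, hXe⟩ := exists_contMDiff_eventuallyEq_extend (n := n)
      (F := EuclideanSpace ℝ (Fin n)) (V := fun q : M => TangentSpace (𝓡 n) q) (t.symm p w)
    refine (h X hX p).congr_of_eventuallyEq ?_
    filter_upwards [hXe] with q hq
    rw [hq, FiberBundle.extend, ← ht, t.apply_mk_symm hp]
  have hsum : ContMDiffAt (𝓡 n) 𝓘(ℝ, EuclideanSpace ℝ (Fin n) →L[ℝ] ℝ) ∞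
      (fun q => ∑ i, ξ q (t.symm q (EuclideanSpace.single i 1)) •
        (EuclideanSpace.proj i : EuclideanSpace ℝ (Fin n) →L[ℝ] ℝ)) p :=
    contMDiffAt_finsetSum fun i _ => (key _).smul contMDiffAt_const
  refine hsum.congr_of_eventuallyEq ?_
  filter_upwards [t.open_baseSet.mem_nhds hp] with q hq
  ext w
  have hw : w = ∑ i, w i • EuclideanSpace.single i (1 : ℝ) := by
    simpa using ((EuclideanSpace.basisFun (Fin n) ℝ).sum_repr w).symm
  have hq' (w : EuclideanSpace ℝ (Fin n)) : t.symm q w = t.symmL ℝ q w := (t.symmL_apply hq w).symm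
  simp only [ContinuousLinearMap.inCoordinates, ← ht, ContinuousLinearMap.comp_apply, hq']
  conv_lhs => rw [hw]
  simp [mul_comm]

end Extension

/-! ### Two Courant algebroid axioms for the twisted Dorfman bracket -/

section CourantAxioms

variable {n : ℕ} {M : Type*} [TopologicalSpace M] [ChartedSpace (EuclideanSpace ℝ (Fin n)) M]

theorem scalar_apply {p : M} (u v : Fib n p) :
    scalar p u v = (v.2.1 u.1 + u.2.1 v.1) / 2 + u.2.2 * v.2.2 := rfl

theorem scalar_comm {p : M} (u v : Fib n p) : scalar p u v = scalar p v u := by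
  simp only [scalar_apply]; ring

theorem scalar_isSymm (p : M) : (scalar (n := n) p).IsSymm := ⟨fun u v => scalar_comm u v⟩

theorem lie_swap (X Y : Π p : M, Tan n p) (p : M) : lie X Y p = - lie Y X p :=
  mlieBracket_swap_apply

variable [IsManifold (𝓡 n) ∞ M]

theorem SmoothSec.mdifferentiableAt {u : Π p : M, Fib n p} (hu : SmoothSec u) (p : M) :
    MDifferentiableAt (𝓡 n) 𝓘(ℝ, ℝ) (fun q => (u q).2.2) p :=
  (hu.2.2 p).mdifferentiableAt (by simp)

theorem dirDeriv_scalar (X : Π p : M, Tan n p) {v w : Π p : M, Fib n p} (hv : SmoothSec v)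
    (hw : SmoothSec w) (p : M) :
    dirDeriv X (fun q => scalar q (v q) (w q)) p =
      (dirDeriv X (fun q => (w q).2.1 (v q).1) p +
        dirDeriv X (fun q => (v q).2.1 (w q).1) p) / 2 +
      (dirDeriv X (fun q => (v q).2.2) p * (w p).2.2 +
        (v p).2.2 * dirDeriv X (fun q => (w q).2.2) p) := by
  have h1 := (hw.2.1.diffAt p).apply (hv.1.diffAt p)
  have h2 := (hv.2.1.diffAt p).apply (hw.1.diffAt p)
  have e : (fun q => scalar q (v q) (w q)) = fun q =>
      (1 / 2 : ℝ) * ((w q).2.1 (v q).1 + (v q).2.1 (w q).1) + (v q).2.2 * (w q).2.2 := by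
    funext q; rw [scalar_apply]; ring
  have h3 : MDifferentiableAt (𝓡 n) 𝓘(ℝ, ℝ)
      (fun q => (w q).2.1 (v q).1 + (v q).2.1 (w q).1) p := h1.add h2
  have h4 : MDifferentiableAt (𝓡 n) 𝓘(ℝ, ℝ)
      (fun q => (1 / 2 : ℝ) * ((w q).2.1 (v q).1 + (v q).2.1 (w q).1)) p :=
    mdifferentiableAt_const.mul h3
  have h5 : MDifferentiableAt (𝓡 n) 𝓘(ℝ, ℝ) (fun q => (v q).2.2 * (w q).2.2) p :=
    (hv.mdifferentiableAt p).mul (hw.mdifferentiableAt p)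
  simp only [dirDeriv]
  rw [e, mvfderiv_fun_add h4 h5, mvfderiv_fun_mul (hv.mdifferentiableAt p) (hw.mdifferentiableAt p),
    mvfderiv_fun_mul mdifferentiableAt_const h3, mvfderiv_fun_add h1 h2, mvfderiv_const]
  simp
  ring

theorem dorfman_form_apply (T : Twist n M) {u v : Π p : M, Fib n p} (hu : SmoothSec u)
    (hv : SmoothSec v) {Z : Π p : M, Tan n p} (hZ : SmoothVF Z) (p : M) :
    (dorfman T u v p).2.1 (Z p) =
      dirDeriv (fun q => (u q).1) (fun q => (v q).2.1 (Z q)) p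
      - (v p).2.1 (lie (fun q => (u q).1) Z p)
      - (dirDeriv (fun q => (v q).1) (fun q => (u q).2.1 (Z q)) p
        - dirDeriv Z (fun q => (u q).2.1 (v q).1) p - (u p).2.1 (lie (fun q => (v q).1) Z p))
      + 2 * (v p).2.2 * dirDeriv Z (fun q => (u q).2.2) p
      + T.H p (v p).1 (u p).1 (Z p)
      - 2 * ((v p).2.2 * T.F p (u p).1 (Z p) - (u p).2.2 * T.F p (v p).1 (Z p)) := by
  have h1 := lieDerivForm_apply (fun q => (u q).1) (hv.2.1.diffAt p) (hZ.diffAt p)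
  have h2 := extDerivForm_apply (hu.2.1.diffAt p) (hv.1.diffAt p) (hZ.diffAt p)
  simp only [dorfman, _root_.add_apply, _root_.sub_apply,
    _root_.smul_apply, h1, h2, smul_eq_mul, dirDeriv]

theorem Twist.F_swap (T : Twist n M) (p : M) (x y : Tan n p) : T.F p x y = - T.F p y x := by
  have h := T.alt_F p (x + y)
  simp only [map_add, _root_.add_apply, T.alt_F] at h
  linarith

theorem Twist.H_swap (T : Twist n M) (p : M) (x y z : Tan n p) :
    T.H p x y z = - T.H p y x z := by
  have h := (T.alt_H p (x + y) z).1
  have e : T.H p (x + y) = T.H p x + T.H p y := (T.H p).map_add x y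
  simp only [e, map_add, _root_.add_apply, (T.alt_H p _ _).1] at h
  linarith

theorem Twist.H_swap_right (T : Twist n M) (p : M) (x y z : Tan n p) :
    T.H p x y z = - T.H p x z y := by
  have h := (T.alt_H p x (y + z)).2
  simp only [map_add, _root_.add_apply, (T.alt_H p _ _).2] at h
  linarith

/-- The Dorfman bracket preserves the scalar product. -/
theorem dirDeriv_scalar_eq_dorfman (T : Twist n M) {u v w : Π p : M, Fib n p} (hu : SmoothSec u)
    (hv : SmoothSec v) (hw : SmoothSec w) (p : M) :
    dirDeriv (fun q => (u q).1) (fun q => scalar q (v q) (w q)) p =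
      scalar p (dorfman T u v p) (w p) + scalar p (v p) (dorfman T u w p) := by
  have h1 := dorfman_form_apply T hu hv hw.1 p
  have h2 := dorfman_form_apply T hu hw hv.1 p
  rw [dirDeriv_scalar _ hv hw, scalar_apply, scalar_apply, h1, h2]
  simp only [dorfman]
  -- Antisymmetry puts the arguments of the Lie bracket, `H` and `F` in a common order, in which the
  -- remaining terms cancel.
  rw [lie_swap (fun q => (w q).1) (fun q => (v q).1), T.H_swap_right p (w p).1,
    T.H_swap p (w p).1, T.H_swap_right p (v p).1 (w p).1, T.F_swap p (w p).1 (v p).1]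
  simp only [map_neg]
  ring

/-- The symmetric part of the Dorfman bracket is the differential of the scalar product. -/
theorem scalar_dorfman_add_dorfman (T : Twist n M) {u v w : Π p : M, Fib n p} (hu : SmoothSec u)
    (hv : SmoothSec v) (hw : SmoothSec w) (p : M) :
    scalar p (dorfman T u v p) (w p) + scalar p (dorfman T v u p) (w p) =
      dirDeriv (fun q => (w q).1) (fun q => scalar q (u q) (v q)) p := by
  have h1 := dorfman_form_apply T hu hv hw.1 p
  have h2 := dorfman_form_apply T hv hu hw.1 p
  rw [dirDeriv_scalar _ hu hv, scalar_apply, scalar_apply, h1, h2]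
  simp only [dorfman]
  rw [lie_swap (fun q => (v q).1) (fun q => (u q).1), T.H_swap p (v p).1,
    T.F_swap p (v p).1 (u p).1]
  simp only [map_neg]
  ring

end CourantAxioms

/-! ### The bracket with `u` commutes with a generalized complex structure -/

section Adjoint

variable {n : ℕ} {M : Type*} [TopologicalSpace M] [ChartedSpace (EuclideanSpace ℝ (Fin n)) M]

theorem finrank_fib (p : M) : Module.finrank ℝ (Fib n p) = 2 * n + 1 := by
  have h1 : Module.finrank ℝ (Tan n p) = n := finrank_euclideanSpace_fin (𝕜 := ℝ)
  have h2 : Module.finrank ℝ (Cotan n p) = n := by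
    rw [← (LinearMap.toContinuousLinearMap (𝕜 := ℝ) (E := Tan n p) (F' := ℝ)).finrank_eq]
    exact Subspace.dual_finrank_eq.trans h1
  rw [Module.finrank_prod, Module.finrank_prod, h1, h2, Module.finrank_self]
  ring

theorem eq_zero_of_scalar_eq_zero {p : M} {x : Fib n p} (h : ∀ y, scalar p x y = 0) : x = 0 := by
  obtain ⟨X, ξ, l⟩ := x
  have h1 : X = 0 := by
    refine (Module.forall_dual_apply_eq_zero_iff ℝ X).1 fun η => ?_
    simpa [scalar_apply] using h (0, LinearMap.toContinuousLinearMap η, 0)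
  have h2 : ξ = 0 := by
    ext Z
    simpa [scalar_apply] using h (Z, 0, 0)
  have h3 : l = 0 := by simpa [scalar_apply] using h (0, 0, 1)
  rw [h1, h2, h3]
  rfl

theorem dirDeriv_eq_zero_of_const (X : Π p : M, Tan n p) {f : M → ℝ} {c : ℝ} (h : ∀ q, f q = c)
    (p : M) : dirDeriv X f p = 0 := by
  rw [show f = fun _ => c from funext h, dirDeriv, mvfderiv_const]
  rfl

variable [IsManifold (𝓡 n) ∞ M]

namespace IsAlmostComplex

variable {Φ : Π p : M, Fib n p →ₗ[ℝ] Fib n p} (hΦ : IsAlmostComplex Φ)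

include hΦ

theorem apply_eq_zero {p : M} {x : Fib n p} (hx : ∀ w ∈ sqNegOne (Φ p), scalar p w x = 0) :
    Φ p x = 0 :=
  apply_eq_zero_of_orthogonal (hΦ.ker p) hx

theorem skew {p : M} (x y : Fib n p) : scalar p (Φ p x) y = - scalar p x (Φ p y) :=
  skew_of_isotropic (scalar_isSymm p) (fun _ => hΦ.apply_eq_zero)
    (fun _ hx _ hy => isotropic_iff_real (hΦ.isotropic p) hx hy) x y

theorem cube {p : M} (x : Fib n p) : Φ p (Φ p (Φ p x)) = - Φ p x :=
  apply_apply_apply_eq_neg (scalar_isSymm p) (fun _ => hΦ.apply_eq_zero) x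

theorem eq_smul_of_ker {u : Π p : M, Fib n p} (hu : IsUnitKernelSection Φ u) {p : M} {x : Fib n p}
    (hx : Φ p x = 0) : ∃ c : ℝ, x = c • u p := by
  refine eq_smul_of_apply_eq_zero (scalar_isSymm p) (fun _ => hΦ.apply_eq_zero) ?_ (hu.ker p)
    ?_ hx
  · have := hΦ.rank p
    rw [eigen] at this
    rw [finrank_fib, finrank_sqNegOne, this]
  · rw [hu.unit p]
    exact pow_ne_zero _ (by norm_num)

/-- An element of `E` is determined by its scalar products with the image and the kernel of `Φ`. -/
theorem ext_scalar {u : Π p : M, Fib n p} (hu : IsUnitKernelSection Φ u) {p : M} {x y : Fib n p}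
    (h : ∀ z, scalar p x (Φ p z) = scalar p y (Φ p z)) (h' : scalar p x (u p) = scalar p y (u p)) :
    x = y := by
  -- Equal products with the image of `Φ` put `x - y` in the kernel by skewness and non-degeneracy.
  -- The product with `u` then kills its coefficient along `u`.
  have hk : Φ p (x - y) = 0 := eq_zero_of_scalar_eq_zero fun z => by
    rw [hΦ.skew, map_sub, LinearMap.sub_apply, h, sub_self, neg_zero]
  obtain ⟨c, hc⟩ := hΦ.eq_smul_of_ker hu hk
  have h1 : scalar p (x - y) (u p) = 0 := by rw [map_sub, LinearMap.sub_apply, h', sub_self]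
  rw [hc, map_smul, LinearMap.smul_apply, hu.unit p, smul_eq_mul] at h1
  have h2 : c = 0 := (mul_eq_zero.1 h1).resolve_right (pow_ne_zero _ (by norm_num))
  rwa [h2, zero_smul, sub_eq_zero] at hc

theorem scalar_apply_unit {u : Π p : M, Fib n p} (hu : IsUnitKernelSection Φ u) {p : M}
    (x : Fib n p) : scalar p (Φ p x) (u p) = 0 := by
  rw [hΦ.skew, hu.ker, map_zero, neg_zero]

end IsAlmostComplex

theorem exists_smoothSec_apply_eq [T2Space M] {p : M} (x : Fib n p) :
    ∃ v, SmoothSec v ∧ v p = x := by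
  obtain ⟨X, hX, hX'⟩ := exists_smoothVF_apply_eq x.1
  obtain ⟨ξ, hξ, hξ'⟩ := exists_smoothForm_apply_eq x.2.1
  exact ⟨fun q => (X q, ξ q, x.2.2), ⟨hX, hξ, contMDiff_const⟩, by simp [hX', hξ']⟩

section UnitKernelSection

variable {T : Twist n M} {Φ : Π p : M, Fib n p →ₗ[ℝ] Fib n p} {u v w : Π p : M, Fib n p}

/-- The product `⟨[u, u], v⟩` is half the derivative of `⟨u, u⟩` along the anchor of `v`, and `⟨u,
u⟩` is constant. -/
theorem IsUnitKernelSection.scalar_dorfman_self (hu : IsUnitKernelSection Φ u) (hv : SmoothSec v)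
    (p : M) : scalar p (dorfman T u u p) (v p) = 0 := by
  have := scalar_dorfman_add_dorfman T hu.smooth hu.smooth hv p
  rw [dirDeriv_eq_zero_of_const _ hu.unit] at this
  linarith

theorem IsUnitKernelSection.dirDeriv_scalar_right (hu : IsUnitKernelSection Φ u) (hv : SmoothSec v)
    (p : M) : scalar p (dorfman T u v p) (u p) =
      dirDeriv (fun q => (u q).1) (fun q => scalar q (v q) (u q)) p := by
  rw [dirDeriv_scalar_eq_dorfman T hu.smooth hv hu.smooth, scalar_comm (v p),
    hu.scalar_dorfman_self hv, add_zero]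

/-- Since `⟨u, v⟩ = 0`, the bracket of `u` and `v` is antisymmetric; since `⟨u, w⟩ = 0`, invariance
under `[v, ·]` moves the bracket onto `w`. -/
theorem scalar_dorfman_of_orthogonal (hu : SmoothSec u) (hv : SmoothSec v) (hw : SmoothSec w)
    (huv : ∀ p, scalar p (u p) (v p) = 0) (huw : ∀ p, scalar p (u p) (w p) = 0) (p : M) :
    scalar p (dorfman T u v p) (w p) = scalar p (u p) (dorfman T v w p) := by
  have h1 := scalar_dorfman_add_dorfman T hu hv hw p
  have h2 := dirDeriv_scalar_eq_dorfman T hv hu hw p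
  rw [dirDeriv_eq_zero_of_const _ huv] at h1
  rw [dirDeriv_eq_zero_of_const _ huw] at h2
  linarith

/-- The Nijenhuis condition for a `B_n`-generalized complex structure. -/
theorem IsGenComplex.scalar_nijenhuis (hΦ : IsGenComplex T Φ) (hu : IsUnitKernelSection Φ u)
    (hv : SmoothSec v) (hw : SmoothSec w) (p : M) :
    scalar p (u p) (dorfman T (fun q => Φ q (Φ q (v q))) (fun q => Φ q (w q)) p) =
      - scalar p (u p) (dorfman T (fun q => Φ q (v q)) (fun q => Φ q (Φ q (w q))) p) := by
  have s := hΦ.1.smooth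
  -- By `Φ³ = -Φ`, the sections `Φ²v + iΦv` and `Φ²w + iΦw` take values in `L`. The imaginary part
  -- of their bracket is then minus `Φ` of the real part, hence orthogonal to `u`.
  have := hΦ.2 _ _ _ _ (s _ (s _ hv)) (s _ hv) (s _ (s _ hw)) (s _ hw)
    (fun q => (mem_eigenspace_I_iff _ _ _).2 ⟨hΦ.1.cube (v q), rfl⟩)
    (fun q => (mem_eigenspace_I_iff _ _ _).2 ⟨hΦ.1.cube (w q), rfl⟩) p
  have h := ((mem_eigenspace_I_iff _ _ _).1 this).1
  have h' := congrArg (fun x => scalar p x (u p)) h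
  simp only [hΦ.1.scalar_apply_unit hu, map_neg, LinearMap.neg_apply, Pi.add_apply, map_add,
    LinearMap.add_apply, scalar_comm _ (u p)] at h'
  linarith

variable [T2Space M]

/-- Paired with `Φ w`, both sides become products of `u` with brackets of sections orthogonal to
`u`, which `scalar_nijenhuis` compares. Paired with `u`, both vanish. -/
theorem IsGenComplex.dorfman_apply_apply (hΦ : IsGenComplex T Φ) (hu : IsUnitKernelSection Φ u)
    (hv : SmoothSec v) (p : M) :
    dorfman T u (fun q => Φ q (Φ q (v q))) p = Φ p (dorfman T u (fun q => Φ q (v q)) p) := by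
  have s := hΦ.1.smooth
  have o (x : Π p : M, Fib n p) (q : M) : scalar q (u q) (Φ q (x q)) = 0 := by
    rw [scalar_comm, hΦ.1.scalar_apply_unit hu]
  refine hΦ.1.ext_scalar hu (fun z => ?_) ?_
  · obtain ⟨w, hw, rfl⟩ := exists_smoothSec_apply_eq z
    rw [hΦ.1.skew,
      scalar_dorfman_of_orthogonal (w := fun q => Φ q (w q)) hu.smooth (s _ (s _ hv)) (s _ hw)
        (o _) (o _),
      scalar_dorfman_of_orthogonal (w := fun q => Φ q (Φ q (w q))) hu.smooth (s _ hv)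
        (s _ (s _ hw)) (o _) (o _)]
    exact hΦ.scalar_nijenhuis hu hv hw p
  · rw [hΦ.1.scalar_apply_unit hu, hu.dirDeriv_scalar_right (s _ (s _ hv)),
      dirDeriv_eq_zero_of_const _ fun q => hΦ.1.scalar_apply_unit hu _]

/-- The unit section of the kernel preserves the generalized complex structure. -/
theorem IsGenComplex.dorfman_apply (hΦ : IsGenComplex T Φ) (hu : IsUnitKernelSection Φ u)
    (hv : SmoothSec v) (p : M) :
    dorfman T u (fun q => Φ q (v q)) p = Φ p (dorfman T u v p) := by
  have s := hΦ.1.smooth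
  refine hΦ.1.ext_scalar hu (fun z => ?_) ?_
  · obtain ⟨w, hw, rfl⟩ := exists_smoothSec_apply_eq z
    -- Transposition: `⟨Φv, Φw⟩ = -⟨v, Φ²w⟩` is differentiated in both forms, and `[u, Φ²w] = Φ[u,
    -- Φw]` cancels the terms in which `w` is bracketed.
    have h1 := dirDeriv_scalar_eq_dorfman T hu.smooth (s _ hv) (s _ hw) p
    have h2 := dirDeriv_scalar_eq_dorfman T hu.smooth hv (s _ (s _ hw)) p
    rw [hΦ.dorfman_apply_apply hu hw] at h2
    have h3 : (fun q => scalar q (Φ q (v q)) (Φ q (w q))) =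
        fun q => - scalar q (v q) (Φ q (Φ q (w q))) := funext fun q => hΦ.1.skew _ _
    have h4 : dirDeriv (fun q => (u q).1) (fun q => - scalar q (v q) (Φ q (Φ q (w q)))) p =
        - dirDeriv (fun q => (u q).1) (fun q => scalar q (v q) (Φ q (Φ q (w q)))) p := by
      simp only [dirDeriv, mvfderiv_fun_neg, _root_.neg_apply]
    rw [h3, h4, hΦ.1.skew] at h1
    rw [hΦ.1.skew]
    linarith
  · rw [hΦ.1.scalar_apply_unit hu, hu.dirDeriv_scalar_right (s _ hv),
      dirDeriv_eq_zero_of_const _ fun q => hΦ.1.scalar_apply_unit hu _]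

end UnitKernelSection

end Adjoint

/-! ### The splitting `E = E₊ ⊕ E₋` and its lifts `s`, `s₊`, `e` -/

theorem eq_zero_of_eq_neg {V : Type*} [AddCommGroup V] [Module ℝ V] {x : V} (h : x = -x) :
    x = 0 := by
  have h' : (2 : ℝ) • x = 0 := by rw [two_smul]; exact add_eq_zero_iff_eq_neg.2 h
  exact (smul_eq_zero.1 h').resolve_left two_ne_zero

section PseudoKahler

variable {n : ℕ} {M : Type*} [TopologicalSpace M] [ChartedSpace (EuclideanSpace ℝ (Fin n)) M]
  [IsManifold (𝓡 n) ∞ M]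

namespace GenMetric

variable (G : GenMetric n M) {p : M}

theorem endo_add {x y : Fib n p} (hx : x ∈ G.Eplus p) (hy : y ∈ G.Eminus p) :
    G.endo p (x + y) = x - y := by
  simp only [endo, LinearMap.sub_apply, map_add,
    Submodule.projection_apply_of_mem_left _ hx, Submodule.projection_apply_of_mem_left _ hy,
    Submodule.projection_apply_of_mem_right _ hx, Submodule.projection_apply_of_mem_right _ hy]
  simp [sub_eq_add_neg]

theorem exists_add_eq (x : Fib n p) : ∃ a ∈ G.Eplus p, ∃ b ∈ G.Eminus p, a + b = x :=
  Submodule.mem_sup.1 ((G.isCompl p).sup_eq_top ▸ Submodule.mem_top)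

theorem endo_endo (x : Fib n p) : G.endo p (G.endo p x) = x := by
  obtain ⟨a, ha, b, hb, rfl⟩ := G.exists_add_eq x
  rw [G.endo_add ha hb, sub_eq_add_neg, G.endo_add ha (Submodule.neg_mem _ hb), sub_neg_eq_add]

theorem mem_Eplus_iff_endo {x : Fib n p} : x ∈ G.Eplus p ↔ G.endo p x = x := by
  constructor
  · intro hx
    simpa using G.endo_add hx (Submodule.zero_mem _)
  · obtain ⟨a, ha, b, hb, rfl⟩ := G.exists_add_eq x
    intro h
    rw [G.endo_add ha hb, sub_eq_add_neg, add_right_inj, eq_comm] at h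
    simpa [eq_zero_of_eq_neg h] using ha

theorem mem_Eminus_iff_endo {x : Fib n p} : x ∈ G.Eminus p ↔ G.endo p x = -x := by
  constructor
  · intro hx
    simpa using G.endo_add (Submodule.zero_mem _) hx
  · obtain ⟨a, ha, b, hb, rfl⟩ := G.exists_add_eq x
    intro h
    rw [G.endo_add ha hb, neg_add, sub_eq_add_neg, add_left_inj] at h
    simpa [eq_zero_of_eq_neg h] using hb

theorem scalar_endo (x y : Fib n p) : scalar p (G.endo p x) y = scalar p x (G.endo p y) := by
  obtain ⟨a, ha, b, hb, rfl⟩ := G.exists_add_eq x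
  obtain ⟨a', ha', b', hb', rfl⟩ := G.exists_add_eq y
  have h1 := ha' b hb
  have h2 : scalar p a b' = 0 := (scalar_comm _ _).trans (ha b' hb')
  rw [G.endo_add ha hb, G.endo_add ha' hb']
  simp only [map_sub, map_add, LinearMap.sub_apply, LinearMap.add_apply]
  have h1 : scalar p b a' = 0 := h1
  rw [h1, h2]
  ring

theorem s_apply (X : Tan n p) : G.s p X = (X, G.σ p X, G.A p X) := rfl

theorem s_mem (X : Tan n p) : G.s p X ∈ G.Eminus p := (G.mem_iff _ _).2 ⟨rfl, rfl⟩

theorem eq_s_of_mem {x : Fib n p} (hx : x ∈ G.Eminus p) : x = G.s p x.1 := by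
  obtain ⟨h1, h2⟩ := (G.mem_iff _ _).1 hx
  exact Prod.ext rfl (Prod.ext h1 h2)

theorem g_apply (X Y : Tan n p) : G.g p X Y = - scalar p (G.s p X) (G.s p Y) := rfl

theorem sPlus_fst (X : Tan n p) : (G.sPlus p X).1 = X := by simp [sPlus, s_apply]

theorem sPlus_form_apply (X Y : Tan n p) : (G.sPlus p X).2.1 Y = G.σ p X Y + 2 * G.g p X Y := by
  simp [sPlus, s_apply]

theorem sPlus_snd (X : Tan n p) : (G.sPlus p X).2.2 = G.A p X := by simp [sPlus, s_apply]

theorem sPlus_mem (X : Tan n p) : G.sPlus p X ∈ G.Eplus p := by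
  intro y hy
  rw [G.eq_s_of_mem hy]
  change scalar p _ _ = 0
  rw [scalar_apply, sPlus_fst, sPlus_form_apply, sPlus_snd, g_apply, scalar_apply]
  simp only [s_apply]
  ring

theorem unitPlus_mem : G.unitPlus p ∈ G.Eplus p := by
  intro y hy
  rw [G.eq_s_of_mem hy]
  change scalar p _ _ = 0
  simp only [scalar_apply, s_apply, unitPlus]
  simp
  ring

theorem scalar_unitPlus_self : scalar p (G.unitPlus p) (G.unitPlus p) = 1 := by
  simp [scalar_apply, unitPlus]

theorem scalar_sPlus_unitPlus (X : Tan n p) : scalar p (G.sPlus p X) (G.unitPlus p) = 0 := by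
  rw [scalar_apply, sPlus_fst, sPlus_snd]
  simp [unitPlus]
  ring

/-- With zero anchor, the product with `e` is the scalar component; once that vanishes,
orthogonality to every `s(Y)` kills the one-form. -/
theorem eq_zero_of_mem_Eplus {x : Fib n p} (hx : x ∈ G.Eplus p) (h : x.1 = 0)
    (h' : scalar p x (G.unitPlus p) = 0) : x = 0 := by
  obtain ⟨X, ξ, l⟩ := x
  obtain rfl : X = 0 := h
  have hl : l = 0 := by simpa [scalar_apply, unitPlus] using h'
  have hξ : ξ = 0 := by
    ext Y
    have : scalar p _ _ = 0 := hx _ (G.s_mem Y)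
    simpa [scalar_apply, s_apply, hl] using this
  rw [hl, hξ]
  rfl

theorem smooth_s {X : Π p : M, Tan n p} (hX : SmoothVF X) : SmoothSec (fun p => G.s p (X p)) :=
  ⟨hX, G.smooth_σ X hX, G.smooth_A.contMDiff_apply hX⟩

end GenMetric

theorem SmoothSec.contMDiff_scalar {v w : Π p : M, Fib n p} (hv : SmoothSec v)
    (hw : SmoothSec w) : ContMDiff (𝓡 n) 𝓘(ℝ, ℝ) ∞ (fun q => scalar q (v q) (w q)) := by
  have h1 := hw.2.1.contMDiff_apply hv.1
  have h2 := hv.2.1.contMDiff_apply hw.1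
  have e : (fun q => scalar q (v q) (w q)) = fun q =>
      (1 / 2 : ℝ) * ((w q).2.1 (v q).1 + (v q).2.1 (w q).1) + (v q).2.2 * (w q).2.2 := by
    funext q; rw [scalar_apply]; ring
  rw [e]
  exact (contMDiff_const.mul (h1.add h2)).add (hv.2.2.mul hw.2.2)

namespace GenMetric

variable (G : GenMetric n M)

theorem contMDiff_g {X Y : Π p : M, Tan n p} (hX : SmoothVF X) (hY : SmoothVF Y) :
    ContMDiff (𝓡 n) 𝓘(ℝ, ℝ) ∞ (fun q => G.g q (X q) (Y q)) :=
  ((G.smooth_s hX).contMDiff_scalar (G.smooth_s hY)).neg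

theorem smooth_sPlus [T2Space M] {X : Π p : M, Tan n p} (hX : SmoothVF X) :
    SmoothSec (fun p => G.sPlus p (X p)) := by
  refine ⟨?_, smoothForm_of_contMDiff_apply fun Y hY => ?_, ?_⟩
  · simpa only [sPlus_fst] using hX
  · simp only [sPlus_form_apply]
    exact ((G.smooth_σ X hX).contMDiff_apply hY).add (contMDiff_const.mul (G.contMDiff_g hX hY))
  · simpa only [sPlus_snd] using G.smooth_A.contMDiff_apply hX

theorem smooth_unitPlus [T2Space M] : SmoothSec (fun p : M => G.unitPlus p) := by
  refine ⟨?_, smoothForm_of_contMDiff_apply fun Y hY => ?_, contMDiff_const⟩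
  · exact contMDiff_zeroSection ℝ (TangentSpace (𝓡 n) : M → Type)
  · exact contMDiff_const.mul (G.smooth_A.contMDiff_apply hY)

end GenMetric

end PseudoKahler

/-! ### The bracket with `u` on `E₊` and `E₋` -/

section Components

variable {n : ℕ} {M : Type*} [TopologicalSpace M] [ChartedSpace (EuclideanSpace ℝ (Fin n)) M]
  [IsManifold (𝓡 n) ∞ M] {T : Twist n M} {G : GenMetric n M}
  {Φ : Π p : M, Fib n p →ₗ[ℝ] Fib n p} {u v : Π p : M, Fib n p}

theorem IsAlmostPseudoHermitian.endo_apply (h : IsAlmostPseudoHermitian G Φ) {p : M}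
    (x : Fib n p) : G.endo p (Φ p x) = Φ p (G.endo p x) :=
  LinearMap.congr_fun (h.2 p) x

/-- In odd dimension the kernel of `Φ` lies in `E₋`. -/
theorem IsAlmostPseudoHermitian.unit_mem_Eminus (hn : Odd n) (h : IsAlmostPseudoHermitian G Φ)
    (hu : IsUnitKernelSection Φ u) (p : M) : u p ∈ G.Eminus p := by
  -- `G.endo` commutes with `Φ`, so it preserves the line spanned by `u`; being an involution, it
  -- acts there by `± 1`.
  obtain ⟨c, hc⟩ := h.1.eq_smul_of_ker hu (p := p) (x := G.endo p (u p)) (by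
    rw [← h.endo_apply, hu.ker, map_zero])
  have hu0 : u p ≠ 0 := fun h0 => by
    have := hu.unit p
    rw [h0, map_zero] at this
    exact pow_ne_zero n (by norm_num : (-1 : ℝ) ≠ 0) this.symm
  have hcc : c * c = 1 := by
    have h1 := G.endo_endo (u p)
    rw [hc, map_smul, hc, smul_smul] at h1
    have h2 : (c * c - 1) • u p = 0 :=
      (sub_smul (c * c) 1 (u p)).trans (sub_eq_zero.2 (h1.trans (one_smul ℝ (u p)).symm))
    linarith [(smul_eq_zero.1 h2).resolve_right hu0]
  rcases mul_self_eq_one_iff.1 hcc with rfl | rfl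
  -- If `u` were in `E₊`, then `Φ² = -1` on `E₋`, so `J₋² = -1` on a tangent space of odd dimension,
  -- and `(det J₋)² = -1`.
  · exfalso
    have hup : u p ∈ G.Eplus p := G.mem_Eplus_iff_endo.2 (by rw [hc, one_smul])
    have hmem (x : Fib n p) (hx : x ∈ G.Eminus p) : Φ p x ∈ G.Eminus p := by
      rw [G.mem_Eminus_iff_endo] at hx ⊢
      rw [h.endo_apply, hx, map_neg]
    have hsq (x : Fib n p) (hx : x ∈ G.Eminus p) : Φ p (Φ p x) = - x := by
      obtain ⟨k, hk⟩ := h.1.eq_smul_of_ker hu (p := p) (x := Φ p (Φ p x) + x) (by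
        rw [map_add, h.1.cube, neg_add_cancel])
      have h1 : Φ p (Φ p x) + x ∈ G.Eminus p := Submodule.add_mem _ (hmem _ (hmem _ hx)) hx
      have h2 : Φ p (Φ p x) + x ∈ G.Eplus p := hk ▸ Submodule.smul_mem _ k hup
      exact eq_neg_of_add_eq_zero_left
        (Submodule.disjoint_def.1 (G.isCompl p).disjoint _ h2 h1)
    have hJ : compJminus G Φ p * compJminus G Φ p = -1 := by
      ext1 Y
      have e : G.s p (Φ p (G.s p Y)).1 = Φ p (G.s p Y) := (G.eq_s_of_mem (hmem _ (G.s_mem Y))).symm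
      change (Φ p (G.s p (Φ p (G.s p Y)).1)).1 = - Y
      rw [e, hsq _ (G.s_mem Y)]
      rfl
    have hdet := congrArg LinearMap.det hJ
    have hrank : Module.finrank ℝ (Tan n p) = n := finrank_euclideanSpace_fin (𝕜 := ℝ)
    rw [map_mul, ← neg_one_smul ℝ (1 : Tan n p →ₗ[ℝ] Tan n p), LinearMap.det_smul, map_one, hrank,
      hn.neg_one_pow] at hdet
    nlinarith [mul_self_nonneg (LinearMap.det (compJminus G Φ p))]
  · exact G.mem_Eminus_iff_endo.2 (hc.trans (neg_one_smul ℝ (u p)))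

/-- This makes the results on `Φ` available for the second structure with the same `u`. -/
theorem IsUnitKernelSection.endo_comp (hu : IsUnitKernelSection Φ u) :
    IsUnitKernelSection (fun p => G.endo p ∘ₗ Φ p) u :=
  ⟨hu.smooth, fun p => by simp [hu.ker p], hu.unit⟩

namespace IsPseudoKahler

variable (hK : IsPseudoKahler T G Φ) (hu : IsUnitKernelSection Φ u)

include hK hu

variable [T2Space M] (hn : Odd n)

include hn

/-- The unit section of the kernel of `Φ` preserves the eigenbundles `E_±` of `G.endo`. -/
theorem endo_dorfman (hv : SmoothSec v) {ε : ℝ} (hε : ε = 1 ∨ ε = -1)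
    (hGv : ∀ p, G.endo p (v p) = ε • v p) (p : M) :
    G.endo p (dorfman T u v p) = ε • dorfman T u v p := by
  have s := hK.1.1.smooth
  have hum := hK.1.unit_mem_Eminus hn hu
  refine hK.1.1.ext_scalar hu (fun z => ?_) ?_
  · obtain ⟨w, hw, rfl⟩ := exists_smoothSec_apply_eq z
    -- Differentiate `⟨v, Φw⟩` and `⟨v, GΦw⟩ = ε⟨v, Φw⟩`. As `[u, GΦw] = GΦ[u, w] = G[u, Φw]`, the
    -- difference leaves `⟨[u, v], GΦw⟩ = ε⟨[u, v], Φw⟩`.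
    have h1 := dirDeriv_scalar_eq_dorfman T hu.smooth hv (s _ hw) p
    have h2 := dirDeriv_scalar_eq_dorfman T hu.smooth hv (hK.2.2.1.smooth _ hw) p
    have h3 := hK.2.2.dorfman_apply hu.endo_comp hw p
    simp only [LinearMap.comp_apply] at h2 h3
    rw [h3, ← hK.2.1.dorfman_apply hu hw, ← G.scalar_endo (v p), hGv] at h2
    have h4 : (fun q => scalar q (v q) (G.endo q (Φ q (w q)))) =
        fun q => ε * scalar q (v q) (Φ q (w q)) := funext fun q => by
      rw [← G.scalar_endo, hGv, map_smul, LinearMap.smul_apply, smul_eq_mul]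
    have h5 : dirDeriv (fun q => (u q).1) (fun q => ε * scalar q (v q) (Φ q (w q))) p =
        ε * dirDeriv (fun q => (u q).1) (fun q => scalar q (v q) (Φ q (w q))) p := by
      simp only [dirDeriv]
      rw [mvfderiv_fun_mul mdifferentiableAt_const
        ((hv.contMDiff_scalar (s _ hw) p).mdifferentiableAt (by simp)), mvfderiv_const]
      simp
    rw [h4, h5, h1] at h2
    rw [G.scalar_endo, map_smul, LinearMap.smul_apply, smul_eq_mul]
    simp only [map_smul, LinearMap.smul_apply, smul_eq_mul] at h2
    linarith
  · rw [G.scalar_endo, G.mem_Eminus_iff_endo.1 (hum p), map_neg, map_smul, LinearMap.smul_apply,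
      smul_eq_mul]
    -- Since `G u = -u`, the `u`-component is automatic for `ε = -1`. For `ε = 1`, `v` in `E₊` is
    -- orthogonal to `u`, so `⟨[u, v], u⟩`, the derivative of `⟨v, u⟩`, vanishes.
    rcases hε with rfl | rfl
    · have h0 (q : M) : scalar q (v q) (u q) = 0 := by
        rw [scalar_comm]
        exact G.mem_Eplus_iff_endo.2 ((hGv q).trans (one_smul _ _)) _ (hum q)
      rw [hu.dirDeriv_scalar_right hv, dirDeriv_eq_zero_of_const _ h0]
      simp
    · ring

theorem dorfman_mem_Eplus (hv : SmoothSec v) (h : ∀ p, v p ∈ G.Eplus p) (p : M) :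
    dorfman T u v p ∈ G.Eplus p := by
  simp only [G.mem_Eplus_iff_endo] at h ⊢
  exact (hK.endo_dorfman hu hn hv (Or.inl rfl)
    (fun q => (h q).trans (one_smul ℝ (v q)).symm) p).trans
    (one_smul ℝ (dorfman T u v p))

theorem dorfman_mem_Eminus (hv : SmoothSec v) (h : ∀ p, v p ∈ G.Eminus p) (p : M) :
    dorfman T u v p ∈ G.Eminus p := by
  simp only [G.mem_Eminus_iff_endo] at h ⊢
  exact (hK.endo_dorfman hu hn hv (Or.inr rfl)
    (fun q => (h q).trans (neg_one_smul ℝ (v q)).symm) p).trans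
    (neg_one_smul ℝ (dorfman T u v p))

/-- The bracket stays in `E₋`, where an element is determined by its anchor. -/
theorem dorfman_s {X : Π p : M, Tan n p} (hX : SmoothVF X) (p : M) :
    dorfman T u (fun q => G.s q (X q)) p = G.s p (lie (compXminus u) X p) :=
  G.eq_s_of_mem (hK.dorfman_mem_Eminus hu hn (G.smooth_s hX) (fun _ => G.s_mem _) p)

/-- The bracket stays in `E₊`, has zero anchor, and is orthogonal to `e` because `⟨e, e⟩` is
constant. -/
theorem dorfman_unitPlus (p : M) : dorfman T u (fun q => G.unitPlus q) p = 0 := by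
  refine G.eq_zero_of_mem_Eplus
    (hK.dorfman_mem_Eplus hu hn G.smooth_unitPlus (fun _ => G.unitPlus_mem) p) ?_ ?_
  · exact congrFun (mlieBracket_zero_right (I := 𝓡 n) (W := compXminus u)) p
  · have := dirDeriv_scalar_eq_dorfman T hu.smooth G.smooth_unitPlus G.smooth_unitPlus p
    rw [dirDeriv_eq_zero_of_const _ fun q => G.scalar_unitPlus_self,
      scalar_comm (G.unitPlus p)] at this
    linarith

/-- Both sides lie in `E₊` over the same vector, and both are orthogonal to `e`: differentiate
`⟨s₊(X), e⟩ = 0` and use `[u, e] = 0`. -/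
theorem dorfman_sPlus {X : Π p : M, Tan n p} (hX : SmoothVF X) (p : M) :
    dorfman T u (fun q => G.sPlus q (X q)) p = G.sPlus p (lie (compXminus u) X p) := by
  rw [← sub_eq_zero]
  refine G.eq_zero_of_mem_Eplus (Submodule.sub_mem _
    (hK.dorfman_mem_Eplus hu hn (G.smooth_sPlus hX) (fun _ => G.sPlus_mem _) p)
    (G.sPlus_mem _)) ?_ ?_
  · rw [Prod.fst_sub, G.sPlus_fst, sub_eq_zero]
    simp only [dorfman, G.sPlus_fst]
    rfl
  · have := dirDeriv_scalar_eq_dorfman T hu.smooth (G.smooth_sPlus hX) G.smooth_unitPlus p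
    rw [dirDeriv_eq_zero_of_const _ fun q => G.scalar_sPlus_unitPlus _,
      hK.dorfman_unitPlus hu hn, map_zero, add_zero] at this
    rw [map_sub, LinearMap.sub_apply, G.scalar_sPlus_unitPlus, ← this, sub_zero]

end IsPseudoKahler

end Components

end BnGeom

/-! ### The theorem, read off through the anchor -/

open BnGeom
theorem mainTheorem5 {n : ℕ} (hn : Odd n) {M : Type*} [TopologicalSpace M] [T2Space M]
    [SecondCountableTopology M] [ChartedSpace (EuclideanSpace ℝ (Fin n)) M]
    [IsManifold (𝓡 n) ∞ M]
    (T : Twist n M) (G : GenMetric n M) (Φ : Π p : M, Fib n p →ₗ[ℝ] Fib n p)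
    (hK : IsPseudoKahler T G Φ)
    (u : Π p : M, Fib n p) (hu : IsUnitKernelSection Φ u) :
    IsKilling G.g (compXminus u) ∧
    VFCommute (compXminus u) (compXplus G Φ) ∧
    PreservesEnd (compXminus u) (compJplus G Φ) ∧
    PreservesEnd (compXminus u) (compJminus G Φ) := by
  have s := hK.1.1.smooth
  refine ⟨⟨hu.smooth.1, fun Y Z hY hZ => ⟨G.contMDiff_g hY hZ, fun p => ?_⟩⟩,
    ⟨hu.smooth.1, (s _ G.smooth_unitPlus).1, fun p => ?_⟩,
    ⟨hu.smooth.1, fun X hX => (s _ (G.smooth_sPlus hX)).1, fun Y hY p => ?_⟩,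
    ⟨hu.smooth.1, fun X hX => (s _ (G.smooth_s hX)).1, fun Y hY p => ?_⟩⟩
  -- The Killing equation is invariance of the scalar product under `[u, ·]`, restricted to `E₋`.
  · have h := dirDeriv_scalar_eq_dorfman T hu.smooth (G.smooth_s hY) (G.smooth_s hZ) p
    rw [hK.dorfman_s hu hn hY, hK.dorfman_s hu hn hZ] at h
    simp only [G.g_apply]
    rw [← neg_add, ← h]
    simp only [dirDeriv, mvfderiv_fun_neg, _root_.neg_apply]
    rfl
  -- The last three claims are the anchors of `[u, Φx] = Φ[u, x]` for `x = e`, `s₊(Y)` and `s(Y)`.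
  · have h := hK.2.1.dorfman_apply hu G.smooth_unitPlus p
    rw [hK.dorfman_unitPlus hu hn, map_zero] at h
    exact congrArg Prod.fst h
  · have h := hK.2.1.dorfman_apply hu (G.smooth_sPlus hY) p
    rw [hK.dorfman_sPlus hu hn hY] at h
    exact congrArg Prod.fst h
  · have h := hK.2.1.dorfman_apply hu (G.smooth_s hY) p
    rw [hK.dorfman_s hu hn hY] at h
    exact congrArg Prod.fst h
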